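/- Throughout, a \emph{circle} in $\mathbb{R}^4$ (with its standard Euclidean inner product) means a round circle or a straight line. A \emph{simple bundle of circles} is a finite or infinite set $S$ of circles passing through $0$, no two of which are tangent at $0$. It is \emph{rectifiable} if there is a germ of ($C^\infty$) diffeomorphism at $0$ that takes the germ at $0$ of each circle of $S$ to the germ of a straight line. For $d\in\mathbb{N}$, we say that $\binom{d+3}{3}$ circles through $0$ are in general position (for degree $d$) if no nonzero homogeneous polynomial of degree $d$ on $\mathbb{R}^4$ vanishes on all of their tangent lines at $0$. Fix any linear isometry $\mathbb{R}^4\cong\mathbb{H}$ with the quaternions. A \emph{left} (resp. \emph{right}) \emph{quaternionic fractional transformation} is a one-to-one map between open subsets of $\mathbb{R}^4$ of the form $T(x)=B(x)^{-1}A(x)$ (resp. $T(x)=A(x)B(x)^{-1}$), where $A,B:\mathbb{R}^4\to\mathbb{H}$ are real affine maps, $B$ has no zero on the domain of $T$, and the product and the inverse are those of $\mathbb{H}$. \textbf{Theorem.} There is a constant $d\in\mathbb{N}$ with the following property. Let $S$ be a simple bundle of circles in $\mathbb{R}^4$ that contains $\binom{d+3}{3}$ circles in general position for degree $d$. If $S$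 is rectifiable, then there is a left or right quaternionic fractional transformation $T:U\to V$, a diffeomorphism between open sets with $0\in V$, such that $T^{-1}$ sends all circles of $S$ to straight lines: for every $C\in S$ there is a straight line $L$ with $T^{-1}(C\cap V)=L\cap U$. -/

import Mathlib

open scoped Topology Quaternion ContDiff

/-- Four-dimensional space with its standard Euclidean inner product. -/
abbrev R4 : Type := EuclideanSpace ℝ (Fin 4)

/-- Straight lines in `ℝ⁴` (not necessarily through the origin). -/
def IsStraightLine (L : Set R4) : Prop :=
  ∃ p v : R4, v ≠ 0 ∧ L = Set.range (fun t : ℝ => p + t • v)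

/-- Round circles in `ℝ⁴`: a sphere of positive radius whose centre lies in an affine 2-plane,
intersected with that plane. -/
def IsRoundCircle (C : Set R4) : Prop :=
  ∃ (P : AffineSubspace ℝ R4) (c : R4) (r : ℝ),
    Module.finrank ℝ P.direction = 2 ∧ c ∈ P ∧ 0 < r ∧ C = (P : Set R4) ∩ Metric.sphere c r

/-- A circle in the extended sense: a round circle or a straight line. -/
def IsCircle (C : Set R4) : Prop := IsRoundCircle C ∨ IsStraightLine C

/-- The set of all vectors tangent at the origin to the curve `C`. For a circle (or line) through
the origin this is its tangent line at the origin. -/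
def tangentAtZero (C : Set R4) : Set R4 := tangentConeAt ℝ C 0

/-- A simple bundle of circles: a collection (finite or infinite) of circles passing through the
origin, no two of which are tangent at the origin. -/
structure IsSimpleBundleOfCircles (S : Set (Set R4)) : Prop where
  isCircle : ∀ C ∈ S, IsCircle C
  zero_mem : ∀ C ∈ S, (0 : R4) ∈ C
  not_tangent : ∀ C ∈ S, ∀ C' ∈ S, C ≠ C' → tangentAtZero C ≠ tangentAtZero C'

/-- The circles `c i` are in general position with respect to homogeneous polynomials of degree
`d`: their tangent lines at the origin do not lie on a common algebraic cone of degree `d`. -/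
def InGeneralPosition (d : ℕ) {N : ℕ} (c : Fin N → Set R4) : Prop :=
  ∀ p : MvPolynomial (Fin 4) ℝ, p.IsHomogeneous d →
    (∀ i, ∀ v ∈ tangentAtZero (c i), MvPolynomial.eval (fun k => v k) p = 0) → p = 0

/-- `S` contains `binom (d + 3) 3` circles in general position with respect to homogeneous
polynomials of degree `d`. The binomial coefficient is the dimension of the space of these
polynomials in four variables, so that this many lines, if they are chosen generically, do not lie
on a common cone of degree `d`, and fewer lines always do. -/
def ContainsCirclesInGeneralPosition (d : ℕ) (S : Set (Set R4)) : Prop :=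
  ∃ c : Fin ((d + 3).choose 3) → Set R4, (∀ i, c i ∈ S) ∧ InGeneralPosition d c

/-- `Φ` is a (smooth) diffeomorphism between two open sets, the first of which contains the
origin. -/
structure IsDiffeoNearZero (Φ : OpenPartialHomeomorph R4 R4) : Prop where
  zero_mem : (0 : R4) ∈ Φ.source
  smooth : ContDiffOn ℝ ∞ Φ Φ.source
  smooth_symm : ContDiffOn ℝ ∞ Φ.symm Φ.target

/-- A collection of curves through the origin is rectifiable if a germ of diffeomorphism at the
origin takes the germ at the origin of each of them to a germ of a straight line. The neighbourhood
in which a curve becomes straight may depend on the curve. -/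
def IsRectifiable (S : Set (Set R4)) : Prop :=
  ∃ Φ : OpenPartialHomeomorph R4 R4, IsDiffeoNearZero Φ ∧
    ∀ C ∈ S, ∃ L, IsStraightLine L ∧ ∀ᶠ x in 𝓝 (0 : R4), x ∈ C ↔ Φ x ∈ L

/-- All curves of `S` become straight lines under `Φ`, on the whole domain of `Φ`. -/
def SendsToLines (Φ : OpenPartialHomeomorph R4 R4) (S : Set (Set R4)) : Prop :=
  ∀ C ∈ S, ∃ L, IsStraightLine L ∧ ∀ x ∈ Φ.source, x ∈ C ↔ Φ x ∈ L

/-- `T` is a left quaternionic fractional transformation `B⁻¹ A` (one-to-one on its open domain),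
where `ℝ⁴` is identified with the quaternions by `e`. -/
def IsLeftQuatFractional (e : R4 ≃ₗᵢ[ℝ] ℍ[ℝ]) (T : OpenPartialHomeomorph R4 R4) : Prop :=
  ∃ A B : R4 →ᵃ[ℝ] ℍ[ℝ], ∀ x ∈ T.source, B x ≠ 0 ∧ e (T x) = (B x)⁻¹ * A x

/-- `T` is a right quaternionic fractional transformation `A B⁻¹`. -/
def IsRightQuatFractional (e : R4 ≃ₗᵢ[ℝ] ℍ[ℝ]) (T : OpenPartialHomeomorph R4 R4) : Prop :=
  ∃ A B : R4 →ᵃ[ℝ] ℍ[ℝ], ∀ x ∈ T.source, B x ≠ 0 ∧ e (T x) = A x * (B x)⁻¹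

/-!
A circle through `0` is a set `{y | ∃ s, y = |y|² a + s v}` with tangent vector `v`, where the
vector `a`, half the curvature vector, matters modulo `v` only. A rectification provides a map `F`,
tangent to the identity at `0`, such that `t ↦ F(t w)` parametrizes near `0` a circle of `S` with
tangent vector `w`, for every circle of `S`. Comparing derivatives at `t = 0` of both sides of the
equation of the circle gives, with `Dₖ(w)` the `k`-th differential of `F` on the diagonal,

* `D₂ ∧ w = 2 |w|² a ∧ w`,
* `D₃ ∧ w = 6 ⟨w, D₂⟩ a ∧ w`,
* `D₄ ∧ w = (8 ⟨w, D₃⟩ + 6 |D₂|²) a ∧ w`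

(`wedge_iteratedDeriv_of_circle`). Eliminating `a` leaves polynomial identities of degrees `6` and
`7` in `w`; they hold on the tangent lines of `S`, hence identically once `S` contains circles in
general position for degree `7`. Modulo the prime polynomial `|w|²` the first gives
`⟨w, D₂⟩ = 0`, then, after division by `|w|²`, also `⟨w, D₃⟩ = 0`, and the second gives `|D₂|² = 0`
(`dvd_mul_star_or_dvd_star_mul`). So on the complex null cone `D₂(w)` and `w` span an isotropic
subspace. In quaternionic terms `D₂ w̄` or `w̄ D₂` vanishes modulo `|w|²`
(`mul_star_eq_zero_or_star_mul_eq_zero`), and it is the same one for all `w` because `|w|²` is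
prime. In the first case `D₂(w) w̄ = |w|² B(w)` with a linear quaternion valued `B`, that is
`D₂(w) = B(w) w`.

The real part of `B` changes `D₂(w)` by multiples of `w` and does not affect the circles. With
`β = - Im B / 2` the transformation `x ↦ (1 + β(x))⁻¹ x` takes the line through `w` to the
circle with the tangent vector `w` and the curvature vector `D₂(w) / |w|²` modulo `w`
(`exists_fractional_sendsToLines`). This circle is the one of `S`. The second case reduces to the
first by quaternionic conjugation, which exchanges left and right transformations.
-/

/-! ### The quadric `∑ xᵢ² = 0` -/

open MvPolynomial in
/-- The polynomial `∑ xᵢ²` in four variables is prime over `ℝ`: as a monic quadratic polynomial in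
the first variable it has no root. -/
theorem prime_sum_X_sq : Prime (∑ i : Fin 4, (X i : MvPolynomial (Fin 4) ℝ) ^ 2) := by
  rw [← MulEquiv.prime_iff (finSuccEquiv ℝ 3).toMulEquiv]
  set s : MvPolynomial (Fin 3) ℝ := ∑ i : Fin 3, X i ^ 2 with hs
  have hP : (finSuccEquiv ℝ 3).toMulEquiv (∑ i : Fin 4, (X i : MvPolynomial (Fin 4) ℝ) ^ 2)
      = Polynomial.X ^ 2 + Polynomial.C s := by
    change finSuccEquiv ℝ 3 _ = _
    simp only [Fin.sum_univ_succ (n := 3), map_add, map_pow, map_sum, finSuccEquiv_X_zero,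
      finSuccEquiv_X_succ, hs]
  rw [hP]
  have hm : (Polynomial.X ^ 2 + Polynomial.C s).Monic :=
    Polynomial.monic_X_pow_add_C s two_ne_zero
  have hdeg : (Polynomial.X ^ 2 + Polynomial.C s).natDegree = 2 := Polynomial.natDegree_X_pow_add_C
  refine Irreducible.prime ?_
  rw [hm.irreducible_iff_roots_eq_zero_of_degree_le_three hdeg.ge (by omega)]
  refine Multiset.eq_zero_of_forall_notMem fun b hb => ?_
  have h0 : b ^ 2 + s = 0 := by simpa using Polynomial.isRoot_of_mem_roots hb
  have h1 := congrArg (eval (fun _ => (1 : ℝ))) h0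
  simp [hs] at h1
  nlinarith [sq_nonneg (eval (fun _ => (1 : ℝ)) b)]

/-- Two orthogonal null quaternions `x`, `d` over a domain satisfy `d x̄ = 0` or `x̄ d = 0`. The
reason is that all products of a component of `d x̄` and a component of `x̄ d` vanish; over an
algebraically closed field this says that an isotropic plane belongs to one of two families. -/
theorem mul_star_eq_zero_or_star_mul_eq_zero {K : Type*} [CommRing K] [IsDomain K] [CharZero K]
    {x d : ℍ[K]} (hx : x.re ^ 2 + x.imI ^ 2 + x.imJ ^ 2 + x.imK ^ 2 = 0)
    (hxd : x.re * d.re + x.imI * d.imI + x.imJ * d.imJ + x.imK * d.imK = 0)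
    (hd : d.re ^ 2 + d.imI ^ 2 + d.imJ ^ 2 + d.imK ^ 2 = 0) :
    d * star x = 0 ∨ star x * d = 0 := by
  obtain ⟨x0, x1, x2, x3⟩ := x
  obtain ⟨d0, d1, d2, d3⟩ := d
  simp only at hx hxd hd
  have hR : x0 * d1 - x1 * d0 - x2 * d3 + x3 * d2 = 0 →
      x0 * d2 + x1 * d3 - x2 * d0 - x3 * d1 = 0 →
      x0 * d3 - x1 * d2 + x2 * d1 - x3 * d0 = 0 →
      star (⟨x0, x1, x2, x3⟩ : ℍ[K]) * ⟨d0, d1, d2, d3⟩ = 0 := by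
    intro h1 h2 h3
    ext <;> simp
    · linear_combination hxd
    · linear_combination h1
    · linear_combination h2
    · linear_combination h3
  have key : ∀ a : K, a * (x0 * d1 - x1 * d0 - x2 * d3 + x3 * d2) = 0 →
      a * (x0 * d2 + x1 * d3 - x2 * d0 - x3 * d1) = 0 →
      a * (x0 * d3 - x1 * d2 + x2 * d1 - x3 * d0) = 0 →
      a = 0 ∨ star (⟨x0, x1, x2, x3⟩ : ℍ[K]) * ⟨d0, d1, d2, d3⟩ = 0 := by
    intro a h₁ h₂ h₃
    by_cases ha : a = 0
    · exact Or.inl ha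
    · exact Or.inr (hR ((mul_eq_zero.mp h₁).resolve_left ha) ((mul_eq_zero.mp h₂).resolve_left ha)
        ((mul_eq_zero.mp h₃).resolve_left ha))
  rcases key (-d0 * x1 + d1 * x0 - d2 * x3 + d3 * x2) (by clear hR key; grind)
    (by clear hR key; grind) (by clear hR key; grind) with h1 | h
  · rcases key (-d0 * x2 + d1 * x3 + d2 * x0 - d3 * x1) (by clear hR key; grind)
      (by clear hR key; grind) (by clear hR key; grind) with h2 | h
    · rcases key (-d0 * x3 - d1 * x2 + d2 * x1 + d3 * x0) (by clear hR key; grind)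
        (by clear hR key; grind) (by clear hR key; grind) with h3 | h
      · left
        change (⟨d0, d1, d2, d3⟩ : ℍ[K]) * star (⟨x0, x1, x2, x3⟩ : ℍ[K]) = 0
        ext <;> simp
        · linear_combination hxd
        · linear_combination h1
        · linear_combination h2
        · linear_combination h3
      · exact Or.inr h
    · exact Or.inr h
  · exact Or.inr h

/-- The quaternion with the given tuple of components. -/
def quatOfFun {K : Type*} [CommRing K] (x : Fin 4 → K) : ℍ[K] := ⟨x 0, x 1, x 2, x 3⟩

section quatOfFun

variable {K : Type*} [CommRing K] (x : Fin 4 → K)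

@[simp] theorem re_quatOfFun : (quatOfFun x).re = x 0 := rfl

@[simp] theorem imI_quatOfFun : (quatOfFun x).imI = x 1 := rfl

@[simp] theorem imJ_quatOfFun : (quatOfFun x).imJ = x 2 := rfl

@[simp] theorem imK_quatOfFun : (quatOfFun x).imK = x 3 := rfl

end quatOfFun

/-- If `u ∧ x = 0` and `∑ xᵢ² = 0`, then `⟨x, u⟩ = 0`. -/
theorem sum_mul_eq_zero_of_wedge {K : Type*} [CommRing K] [IsDomain K] {x u : Fin 4 → K}
    (hx0 : x ≠ 0) (hx : ∑ i, x i ^ 2 = 0) (h : ∀ i j, u i * x j - u j * x i = 0) :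
    ∑ i, x i * u i = 0 := by
  obtain ⟨j, hj⟩ := Function.ne_iff.mp hx0
  refine (mul_eq_zero.mp ?_).resolve_right hj
  have : ∑ i, x i * (u i * x j - u j * x i) = 0 := by simp [h]
  calc (∑ i, x i * u i) * x j
      = ∑ i, x i * (u i * x j - u j * x i) + u j * ∑ i, x i ^ 2 := by
        rw [Finset.sum_mul, Finset.mul_sum, ← Finset.sum_add_distrib]
        exact Finset.sum_congr rfl fun i _ => by ring
    _ = 0 := by rw [this, hx, mul_zero, add_zero]

/-- The algebraic consequences of the identities satisfied by the derivatives `d₂`, `d₃`, `d₄` of a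
map taking lines to circles. The third order identity gives `⟨x, d₂⟩ = 0` on the null quadric
`P = 0`, hence `⟨x, d₃⟩ = 0` there after division by `P`, and then the fourth order identity
gives `|d₂|² = 0` there. -/
theorem dvd_mul_star_or_dvd_star_mul {A : Type*} [CommRing A] [IsDomain A] [CharZero A]
    {P : A} (hP : Prime P) [CharZero (A ⧸ Ideal.span {P})]
    {x d₂ d₃ d₄ : Fin 4 → A} (hxP : ∑ i, x i ^ 2 = P) (hx : ∃ i, ¬ P ∣ x i)
    (h₃ : ∀ i j, 2 * P * (d₃ i * x j - d₃ j * x i)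
      = 6 * (∑ k, x k * d₂ k) * (d₂ i * x j - d₂ j * x i))
    (h₄ : ∀ i j, 2 * P * (d₄ i * x j - d₄ j * x i)
      = (8 * (∑ k, x k * d₃ k) + 6 * ∑ k, d₂ k ^ 2) * (d₂ i * x j - d₂ j * x i)) :
    (∃ b : Fin 4 → A, quatOfFun d₂ * star (quatOfFun x) = P • quatOfFun b) ∨
      (∃ b : Fin 4 → A, star (quatOfFun x) * quatOfFun d₂ = P • quatOfFun b) := by
  set I := Ideal.span {P} with hI
  have hprime : I.IsPrime := (Ideal.span_singleton_prime hP.ne_zero).mpr hP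
  let π : A →+* A ⧸ I := Ideal.Quotient.mk I
  have hπ : ∀ a, π a = 0 ↔ P ∣ a := fun a => by
    rw [Ideal.Quotient.eq_zero_iff_mem, hI, Ideal.mem_span_singleton]
  have hπP : π P = 0 := (hπ P).mpr dvd_rfl
  have hx0 : (fun i => π (x i)) ≠ 0 := by
    obtain ⟨i, hi⟩ := hx
    exact Function.ne_iff.mpr ⟨i, fun h => hi ((hπ _).mp h)⟩
  have hxx : ∑ i, π (x i) ^ 2 = 0 := by rw [← hπP, ← hxP]; simp
  have h6 : (6 : A ⧸ I) ≠ 0 := by norm_num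
  have hS : ∑ i, π (x i) * π (d₂ i) = 0 := by
    by_contra hne
    refine hne (sum_mul_eq_zero_of_wedge hx0 hxx fun i j => ?_)
    have := congrArg π (h₃ i j)
    simp only [map_mul, map_sub, map_sum, hπP, map_ofNat, mul_zero, zero_mul] at this
    simpa [h6, hne] using this.symm
  obtain ⟨l, hl⟩ : P ∣ ∑ k, x k * d₂ k := (hπ _).mp (by simpa using hS)
  have hT : ∑ i, π (x i) * π (d₃ i) = 0 := by
    have h₃' : ∀ i j, (d₃ i - 3 * l * d₂ i) * x j - (d₃ j - 3 * l * d₂ j) * x i = 0 := by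
      intro i j
      refine (mul_eq_zero.mp ?_).resolve_left (mul_ne_zero two_ne_zero hP.ne_zero)
      have := h₃ i j
      rw [hl] at this
      linear_combination this
    have := sum_mul_eq_zero_of_wedge (u := fun i => π (d₃ i - 3 * l * d₂ i)) hx0 hxx
      (fun i j => by simpa using congrArg π (h₃' i j))
    have h2 : ∑ i, π (x i) * π (d₃ i - 3 * l * d₂ i)
        = ∑ i, π (x i) * π (d₃ i) - 3 * π l * ∑ i, π (x i) * π (d₂ i) := by
      rw [Finset.mul_sum, ← Finset.sum_sub_distrib]
      exact Finset.sum_congr rfl fun i _ => by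
        rw [map_sub, map_mul, map_mul, map_ofNat]; ring
    rw [h2, hS] at this
    simpa using this
  have hN : ∑ i, π (d₂ i) ^ 2 = 0 := by
    by_contra hne
    have hw : ∀ i j, π (d₂ i) * π (x j) - π (d₂ j) * π (x i) = 0 := by
      intro i j
      have := congrArg π (h₄ i j)
      simp only [map_mul, map_sub, map_sum, map_add, map_pow, hπP, hT, map_ofNat, mul_zero,
        zero_mul, zero_add] at this
      simpa [h6, hne] using this.symm
    obtain ⟨j, hj⟩ := Function.ne_iff.mp hx0
    refine hne ((mul_eq_zero.mp ?_).resolve_right hj)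
    calc (∑ i, π (d₂ i) ^ 2) * π (x j)
        = ∑ i, π (d₂ i) * (π (d₂ i) * π (x j) - π (d₂ j) * π (x i))
          + π (d₂ j) * ∑ i, π (x i) * π (d₂ i) := by
          rw [Finset.sum_mul, Finset.mul_sum, ← Finset.sum_add_distrib]
          exact Finset.sum_congr rfl fun i _ => by ring
      _ = 0 := by simp [hw, hS]
  simp only [Fin.sum_univ_four] at hxx hS hN
  have hlift : ∀ p : ℍ[A], (P ∣ p.re ∧ P ∣ p.imI ∧ P ∣ p.imJ ∧ P ∣ p.imK) →
      ∃ b : Fin 4 → A, p = P • quatOfFun b := by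
    rintro p ⟨⟨b0, h0⟩, ⟨b1, h1⟩, ⟨b2, h2⟩, ⟨b3, h3⟩⟩
    exact ⟨![b0, b1, b2, b3], by ext <;> simp [h0, h1, h2, h3]⟩
  rcases mul_star_eq_zero_or_star_mul_eq_zero (x := quatOfFun fun i => π (x i))
    (d := quatOfFun fun i => π (d₂ i)) hxx hS hN with h | h
  · refine Or.inl (hlift _ ?_)
    simp only [← hπ]
    simpa [Quaternion.ext_iff] using h
  · refine Or.inr (hlift _ ?_)
    simp only [← hπ]
    simpa [Quaternion.ext_iff] using h

/-! ### Homogeneous polynomials on `ℝ⁴` -/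

open MvPolynomial in
/-- The diagonal of a multilinear form is given by a homogeneous polynomial. -/
theorem exists_isHomogeneous_eval_eq_multilinear {n : ℕ}
    (M : ContinuousMultilinearMap ℝ (fun _ : Fin n => R4) ℝ) :
    ∃ p : MvPolynomial (Fin 4) ℝ, p.IsHomogeneous n ∧
      ∀ w : R4, eval (fun k => w k) p = M fun _ => w := by
  refine ⟨∑ σ : Fin n → Fin 4, C (M fun i => EuclideanSpace.single (σ i) (1 : ℝ)) * ∏ i, X (σ i),
    IsHomogeneous.sum _ _ _ fun σ _ => ?_, fun w => ?_⟩
  · have h := IsHomogeneous.prod (R := ℝ) Finset.univ (fun i : Fin n => (X (σ i) : MvPolynomial (Fin 4) ℝ))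
      (fun _ => 1) fun i _ => isHomogeneous_X ℝ (σ i)
    simpa using (isHomogeneous_C (Fin 4) _).mul h
  · have hw : w = ∑ j : Fin 4, w j • EuclideanSpace.single j (1 : ℝ) := by
      ext i
      simp [Finset.sum_apply, Pi.single_apply]
    conv_rhs => rw [hw]
    rw [← ContinuousMultilinearMap.coe_coe, MultilinearMap.map_sum]
    simp only [MultilinearMap.map_smul_univ, map_sum, map_mul, map_prod, eval_C, eval_X, smul_eq_mul]
    exact Finset.sum_congr rfl fun σ _ => mul_comm _ _

open MvPolynomial in
/-- Lines in general position for degree `d` do not lie on a cone of smaller degree either. -/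
theorem InGeneralPosition.eq_zero_of_le {d n N : ℕ} {c : Fin N → Set R4}
    (h : InGeneralPosition d c) (hn : n ≤ d) {p : MvPolynomial (Fin 4) ℝ} (hp : p.IsHomogeneous n)
    (hc : ∀ i, ∀ v ∈ tangentAtZero (c i), eval (fun k => v k) p = 0) : p = 0 := by
  have h1 : p * X 0 ^ (d - n) = 0 := by
    refine h _ ?_ fun i v hv => by simp [hc i v hv]
    have := hp.mul ((isHomogeneous_X ℝ (0 : Fin 4)).pow (d - n))
    rwa [one_mul, Nat.add_sub_cancel' hn] at this
  exact (mul_eq_zero.mp h1).resolve_right (pow_ne_zero _ (X_ne_zero 0))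

/-- A function which is differentiable at the origin and homogeneous of degree `1` is linear. -/
theorem eq_fderiv_of_homogeneous {E : Type*} [NormedAddCommGroup E] [NormedSpace ℝ E] {g : E → ℝ}
    (hg : DifferentiableAt ℝ g 0) (h : ∀ (t : ℝ) (w : E), g (t • w) = t * g w) (w : E) :
    g w = fderiv ℝ g 0 w := by
  have h0 : DifferentiableAt ℝ g ((0 : ℝ) • w) := by simpa using hg
  have h1 : HasDerivAt (fun t : ℝ => g (t • w)) (fderiv ℝ g ((0 : ℝ) • w) w) 0 := by
    have h2 : HasDerivAt (fun t : ℝ => t • w) w 0 := by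
      simpa using (hasDerivAt_id (0 : ℝ)).smul_const w
    exact h0.hasFDerivAt.comp_hasDerivAt 0 h2
  have h2 : HasDerivAt (fun t : ℝ => g (t • w)) (g w) 0 := by
    simp only [h]
    simpa using (hasDerivAt_id (0 : ℝ)).mul_const (g w)
  simpa using h2.unique h1

open MvPolynomial in
/-- A polynomial whose product with `|w|²` is homogeneous of degree `3` is a linear form. -/
theorem exists_linear_of_norm_sq_mul {b : MvPolynomial (Fin 4) ℝ} {g : R4 → ℝ}
    (hg : ∀ (t : ℝ) (w : R4), g (t • w) = t ^ 3 * g w)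
    (hb : ∀ w : R4, g w = ‖w‖ ^ 2 * eval (fun k => w k) b) :
    ∃ B : R4 →L[ℝ] ℝ, ∀ w : R4, B w = eval (fun k => w k) b := by
  have hd : Differentiable ℝ fun w : R4 => eval (fun k => w k) b := by
    have := (AnalyticOnNhd.eval_mvPolynomial (𝕜 := ℝ) b).differentiableOn
    have h2 : Differentiable ℝ fun w : R4 => (fun k => w k : Fin 4 → ℝ) := by fun_prop
    exact (differentiableOn_univ.mp this).comp h2
  have hne : ∀ (t : ℝ) (w : R4), t ≠ 0 → w ≠ 0 →
      eval (fun k => (t • w) k) b = t * eval (fun k => w k) b := by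
    intro t w ht hw
    have h1 := hg t w
    rw [hb, hb, norm_smul, mul_pow, Real.norm_eq_abs, sq_abs] at h1
    have h2 : t ^ 2 * ‖w‖ ^ 2 ≠ 0 := by positivity
    refine mul_left_cancel₀ h2 ?_
    linear_combination h1
  have h0 : eval (fun k => (0 : R4) k) b = 0 := by
    -- by continuity, the value at `0` is the limit of `t * b(w)` as `t → 0`
    obtain ⟨w, hw⟩ := exists_ne (0 : R4)
    have h1 : Filter.Tendsto (fun t : ℝ => eval (fun k => (t • w) k) b) (𝓝[≠] 0)
        (𝓝 (eval (fun k => (0 : R4) k) b)) := by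
      have hc : Continuous fun t : ℝ => eval (fun k => (t • w) k) b :=
        hd.continuous.comp (continuous_id.smul continuous_const)
      have := hc.tendsto 0
      simp only [zero_smul] at this
      exact this.mono_left nhdsWithin_le_nhds
    have h2 : Filter.Tendsto (fun t : ℝ => t * eval (fun k => w k) b) (𝓝[≠] 0) (𝓝 0) := by
      have hc : Continuous fun t : ℝ => t * eval (fun k => w k) b := by fun_prop
      have := hc.tendsto 0
      simp only [zero_mul] at this
      exact this.mono_left nhdsWithin_le_nhds
    refine tendsto_nhds_unique (h1.congr' ?_) h2
    filter_upwards [self_mem_nhdsWithin] with t ht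
    exact hne t w ht hw
  refine ⟨fderiv ℝ (fun w : R4 => eval (fun k => w k) b) 0, fun w =>
    (eq_fderiv_of_homogeneous hd.differentiableAt (fun t w => ?_) w).symm⟩
  rcases eq_or_ne t 0 with rfl | ht
  · rw [zero_smul, h0, zero_mul]
  rcases eq_or_ne w 0 with rfl | hw
  · rw [smul_zero, h0, mul_zero]
  exact hne t w ht hw

/-! ### Circles through the origin -/

/-- The circle or line through `0` with tangent vector `v` and curvature vector `2 a` (modulo `v`):
it is the image of the line `a + ℝ v` under the inversion `x ↦ x / |x|²`, together with `0`. -/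
def circleThroughZero (v a : R4) : Set R4 := {y | ∃ s : ℝ, y = ‖y‖ ^ 2 • a + s • v}

theorem IsCircle.exists_eq_circleThroughZero {C : Set R4} (hC : IsCircle C) (h0 : (0 : R4) ∈ C) :
    ∃ v a : R4, v ≠ 0 ∧ C = circleThroughZero v a := by
  rcases hC with ⟨P, c, r, hP, hcP, hr, rfl⟩ | ⟨p, v, hv, rfl⟩
  · have h0P : (0 : R4) ∈ P := h0.1
    have hmem : ∀ y, y ∈ P ↔ y ∈ P.direction := fun y => by
      simpa using (AffineSubspace.vsub_left_mem_direction_iff_mem h0P y).symm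
    have hrc : ‖c‖ = r := by simpa [dist_eq_norm] using h0.2
    have hc0 : c ≠ 0 := by
      rintro rfl
      simp at hrc
      exact hr.ne hrc
    have hcD : c ∈ P.direction := (hmem c).mp hcP
    -- a vector of the plane orthogonal to the radius spans the tangent line
    obtain ⟨v, hvD, hv0, hvc⟩ : ∃ v ∈ P.direction, v ≠ 0 ∧ inner ℝ c v = 0 := by
      obtain ⟨w, hwD, hw⟩ : ∃ w ∈ P.direction, w ∉ (ℝ ∙ c : Submodule ℝ R4) := by
        by_contra! hcon
        have h1 := Submodule.finrank_mono (show P.direction ≤ ℝ ∙ c from hcon)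
        rw [hP, finrank_span_singleton hc0] at h1
        omega
      refine ⟨w - (inner ℝ c w / ‖c‖ ^ 2) • c,
        P.direction.sub_mem hwD (P.direction.smul_mem _ hcD), fun h => hw ?_, ?_⟩
      · rw [sub_eq_zero.mp h]
        exact Submodule.smul_mem _ _ (Submodule.mem_span_singleton_self c)
      · rw [inner_sub_right, inner_smul_right, real_inner_self_eq_norm_sq,
          div_mul_cancel₀ _ (by positivity), sub_self]
    have hspan : ∀ y ∈ P.direction, ∃ α β : ℝ, y = α • c + β • v := by
      have hli : LinearIndependent ℝ ![c, v] := by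
        rw [LinearIndependent.pair_iff]
        intro α β hαβ
        have h1 : inner ℝ c (α • c + β • v) = 0 := by rw [hαβ, inner_zero_right]
        rw [inner_add_right, inner_smul_right, inner_smul_right, hvc, real_inner_self_eq_norm_sq,
          mul_zero, add_zero] at h1
        have hα : α = 0 := (mul_eq_zero.mp h1).resolve_right (by positivity)
        rw [hα, zero_smul, zero_add] at hαβ
        exact ⟨hα, (smul_eq_zero.mp hαβ).resolve_right hv0⟩
      have hle : Submodule.span ℝ {c, v} ≤ P.direction := by
        rw [Submodule.span_le]
        rintro z (rfl | rfl)
        exacts [hcD, hvD]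
      have heq : Submodule.span ℝ {c, v} = P.direction := by
        refine Submodule.eq_of_le_of_finrank_eq hle ?_
        rw [hP, ← Matrix.range_cons_cons_empty c v ![]]
        exact (finrank_span_eq_card hli).trans (by simp)
      intro y hy
      rw [← heq, Submodule.mem_span_pair] at hy
      obtain ⟨α, β, h⟩ := hy
      exact ⟨α, β, h.symm⟩
    refine ⟨v, (2 * ‖c‖ ^ 2)⁻¹ • c, hv0, ?_⟩
    have hcc : ‖c‖ ^ 2 ≠ 0 := by positivity
    have hsph : ∀ y : R4, y ∈ Metric.sphere c r ↔ ‖y‖ ^ 2 = 2 * inner ℝ c y := by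
      intro y
      rw [mem_sphere_iff_norm, ← hrc, ← sq_eq_sq₀ (norm_nonneg _) (norm_nonneg _),
        norm_sub_sq_real, real_inner_comm y c]
      constructor <;> intro h <;> linarith
    ext y
    constructor
    · rintro ⟨hyP, hyS⟩
      obtain ⟨α, β, rfl⟩ := hspan y ((hmem y).mp hyP)
      refine ⟨β, ?_⟩
      rw [(hsph _).mp hyS, inner_add_right, inner_smul_right, inner_smul_right, hvc,
        real_inner_self_eq_norm_sq, smul_smul]
      congr 2
      field_simp
      ring
    · rintro ⟨s, hs⟩
      have hyD : y ∈ P.direction := by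
        rw [hs]
        exact P.direction.add_mem (P.direction.smul_mem _ (P.direction.smul_mem _ hcD))
          (P.direction.smul_mem _ hvD)
      refine ⟨(hmem y).mpr hyD, (hsph y).mpr ?_⟩
      have : inner ℝ c y = inner ℝ c (‖y‖ ^ 2 • (2 * ‖c‖ ^ 2)⁻¹ • c + s • v) := by rw [← hs]
      rw [this, inner_add_right, inner_smul_right, inner_smul_right, inner_smul_right, hvc,
        real_inner_self_eq_norm_sq]
      field_simp
      ring
  · obtain ⟨t₀, ht₀⟩ := h0
    refine ⟨v, 0, hv, ?_⟩
    have hp : p = (-t₀) • v := by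
      rw [neg_smul]
      exact eq_neg_of_add_eq_zero_left ht₀
    ext y
    simp only [circleThroughZero, smul_zero, zero_add, Set.mem_range, Set.mem_ofPred_eq, hp]
    constructor
    · rintro ⟨t, rfl⟩
      exact ⟨-t₀ + t, by rw [add_smul]⟩
    · rintro ⟨s, rfl⟩
      exact ⟨s + t₀, by rw [← add_smul]; congr 1; ring⟩

theorem circleThroughZero_smul (v a : R4) {r : ℝ} (hr : r ≠ 0) :
    circleThroughZero (r • v) a = circleThroughZero v a := by
  ext y
  constructor
  · rintro ⟨s, hs⟩
    exact ⟨s * r, by rw [mul_smul]; exact hs⟩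
  · rintro ⟨s, hs⟩
    exact ⟨s * r⁻¹, by rw [smul_smul, mul_assoc, inv_mul_cancel₀ hr, mul_one]; exact hs⟩

theorem tangentAtZero_circleThroughZero_subset (v a : R4) :
    tangentAtZero (circleThroughZero v a) ⊆ (ℝ ∙ v : Submodule ℝ R4) := by
  intro u hu
  obtain ⟨ι, l, hl, c, d, hd, hmem, hcd⟩ := exists_fun_of_mem_tangentConeAt hu
  have h1 : Filter.Tendsto (fun n => c n • d n - (inner ℝ (c n • d n) (d n)) • a) l (𝓝 u) := by
    have := hcd.sub ((hcd.inner (𝕜 := ℝ) hd).smul_const a)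
    simpa using this
  refine (Submodule.closed_of_finiteDimensional (ℝ ∙ v : Submodule ℝ R4)).mem_of_tendsto h1 ?_
  filter_upwards [hmem] with n hn
  obtain ⟨s, hs⟩ := hn
  rw [zero_add] at hs
  refine Submodule.mem_span_singleton.mpr ⟨c n * s, ?_⟩
  have hsv : s • v = d n - ‖d n‖ ^ 2 • a := by
    rw [eq_sub_iff_add_eq, add_comm]
    exact hs.symm
  rw [mul_smul, hsv, smul_sub, smul_smul, real_inner_smul_left, real_inner_self_eq_norm_sq]

/-! ### Derivatives along lines of a rectifying map -/

/-- A map which is smooth on a neighbourhood of `0` has the same germ at `0` as a smooth map. -/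
theorem exists_contDiff_eventuallyEq_of_contDiffOn {E F : Type*} [NormedAddCommGroup E]
    [InnerProductSpace ℝ E] [NormedAddCommGroup F] [NormedSpace ℝ F]
    {f : E → F} {s : Set E} (hs : IsOpen s) (h0 : (0 : E) ∈ s) (hf : ContDiffOn ℝ ∞ f s) :
    ∃ g : E → F, ContDiff ℝ ∞ g ∧ g =ᶠ[𝓝 0] f := by
  obtain ⟨r, hr, hball⟩ := Metric.isOpen_iff.mp hs 0 h0
  let χ : ContDiffBump (0 : E) := ⟨r / 4, r / 2, by positivity, by linarith⟩
  refine ⟨fun x => χ x • f x, contDiff_iff_contDiffAt.mpr fun x => ?_, ?_⟩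
  · by_cases hx : x ∈ Metric.ball (0 : E) r
    · exact χ.contDiff.contDiffAt.smul (hf.contDiffAt (hs.mem_nhds (hball hx)))
    · have h1 : ∀ᶠ y in 𝓝 x, r / 2 < dist y 0 := by
        refine (continuous_id.dist continuous_const).continuousAt.eventually_const_lt ?_
        have : r ≤ dist x 0 := not_lt.mp hx
        change r / 2 < dist x 0
        linarith
      refine (contDiffAt_const (c := (0 : F))).congr_of_eventuallyEq ?_
      filter_upwards [h1] with y hy
      rw [χ.zero_of_le_dist (le_of_lt hy), zero_smul]
  · filter_upwards [χ.eventuallyEq_one] with x hx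
    rw [hx, Pi.one_apply, one_smul]

/-- Vectors tangent to a curve in a circle through `0` are tangent to the circle. -/
theorem mem_span_of_hasDerivAt_circle {γ : ℝ → R4} {v a w : R4} (hγ : HasDerivAt γ w 0)
    (h0 : γ 0 = 0) (h : ∀ᶠ t in 𝓝 (0 : ℝ), γ t ∈ circleThroughZero v a) :
    w ∈ (ℝ ∙ v : Submodule ℝ R4) := by
  apply tangentAtZero_circleThroughZero_subset v a
  have h1 := (hγ.hasFDerivAt.hasFDerivWithinAt
    (s := {t | γ t ∈ circleThroughZero v a})).mapsTo_tangent_cone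
  have h2 : (1 : ℝ) ∈ tangentConeAt ℝ {t | γ t ∈ circleThroughZero v a} 0 := by
    rw [tangentConeAt_of_mem_nhds h]
    trivial
  have h3 := h1 h2
  rw [h0] at h3
  have h4 := tangentConeAt_mono (𝕜 := ℝ) (x := (0 : R4)) (Set.image_subset_iff.mpr (fun t ht => ht) :
    γ '' {t | γ t ∈ circleThroughZero v a} ⊆ circleThroughZero v a) h3
  simpa [tangentAtZero] using h4

/-- A rectifiable bundle of circles is the image of a bundle of lines under a map which is tangent
to the identity at `0`. -/
theorem IsRectifiable.exists_map_of_circles {S : Set (Set R4)} (hS : IsRectifiable S)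
    (hc : ∀ C ∈ S, IsCircle C) (h0 : ∀ C ∈ S, (0 : R4) ∈ C) :
    ∃ F : R4 → R4, ContDiff ℝ ∞ F ∧ F 0 = 0 ∧ HasFDerivAt F (ContinuousLinearMap.id ℝ R4) 0 ∧
      ∀ C ∈ S, ∃ w a : R4, w ≠ 0 ∧ C = circleThroughZero w a ∧
        ∀ᶠ t in 𝓝 (0 : ℝ), F (t • w) ∈ C := by
  obtain ⟨Φ, ⟨hΦ0, hsm, hsm'⟩, hΦ⟩ := hS
  have hy0 : Φ 0 ∈ Φ.target := Φ.map_source hΦ0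
  have hd : HasFDerivAt Φ (fderiv ℝ Φ 0) 0 :=
    ((hsm.contDiffAt (Φ.open_source.mem_nhds hΦ0)).differentiableAt (by simp)).hasFDerivAt
  have hd' : HasFDerivAt Φ.symm (fderiv ℝ Φ.symm (Φ 0)) (Φ 0) :=
    ((hsm'.contDiffAt (Φ.open_target.mem_nhds hy0)).differentiableAt (by simp)).hasFDerivAt
  set A := fderiv ℝ Φ 0 with hA
  set M := fderiv ℝ Φ.symm (Φ 0) with hM
  have hMA : M.comp A = ContinuousLinearMap.id ℝ R4 := by
    refine (hd'.comp 0 hd).unique ((hasFDerivAt_id (0 : R4)).congr_of_eventuallyEq ?_)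
    filter_upwards [Φ.open_source.mem_nhds hΦ0] with x hx
    exact Φ.left_inv hx
  have hAM : A.comp M = ContinuousLinearMap.id ℝ R4 := by
    have hd0 : HasFDerivAt Φ A (Φ.symm (Φ 0)) := by rwa [Φ.left_inv hΦ0]
    refine (hd0.comp (Φ 0) hd').unique ((hasFDerivAt_id (Φ 0)).congr_of_eventuallyEq ?_)
    filter_upwards [Φ.open_target.mem_nhds hy0] with x hx
    exact Φ.right_inv hx
  have haff : ContDiff ℝ ∞ fun x : R4 => Φ 0 + A x := contDiff_const.add A.contDiff
  obtain ⟨F, hF, hFeq⟩ := exists_contDiff_eventuallyEq_of_contDiffOn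
    (f := fun x => Φ.symm (Φ 0 + A x)) (Φ.open_target.preimage haff.continuous)
    (by simpa using hy0) (hsm'.comp haff.contDiffOn fun x hx => hx)
  have hF0 : F 0 = 0 := by
    rw [hFeq.eq_of_nhds, map_zero, add_zero, Φ.left_inv hΦ0]
  have hFd : HasFDerivAt F (ContinuousLinearMap.id ℝ R4) 0 := by
    refine HasFDerivAt.congr_of_eventuallyEq ?_ hFeq
    rw [← hMA]
    have h1 : HasFDerivAt (fun x : R4 => Φ 0 + A x) A 0 := A.hasFDerivAt.const_add _
    have h2 : HasFDerivAt Φ.symm M (Φ 0 + A 0) := by simpa using hd'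
    exact h2.comp 0 h1
  refine ⟨F, hF, hF0, hFd, fun C hC => ?_⟩
  obtain ⟨L, ⟨p, u, hu, rfl⟩, hL⟩ := hΦ C hC
  obtain ⟨s₀, hs₀⟩ := hL.self_of_nhds.mp (h0 C hC)
  have hAw : A (M u) = u := congrArg (fun T : R4 →L[ℝ] R4 => T u) hAM
  have hw : M u ≠ 0 := by
    intro h
    rw [h, map_zero] at hAw
    exact hu hAw.symm
  have hline : Continuous fun t : ℝ => t • M u := by fun_prop
  have hline0 : Filter.Tendsto (fun t : ℝ => t • M u) (𝓝 0) (𝓝 0) := by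
    simpa using hline.tendsto 0
  have hmem : ∀ᶠ t in 𝓝 (0 : ℝ), F (t • M u) ∈ C := by
    have hF0' : Filter.Tendsto (fun t : ℝ => F (t • M u)) (𝓝 0) (𝓝 0) := by
      have := (hF.continuous.tendsto 0).comp hline0
      rwa [hF0] at this
    have hT : ∀ᶠ x : R4 in 𝓝 0, Φ 0 + A x ∈ Φ.target :=
      (Φ.open_target.preimage haff.continuous).mem_nhds (by simpa using hy0)
    filter_upwards [hF0'.eventually hL, hline0.eventually hFeq, hline0.eventually hT]
      with t h1 h2 h3
    refine h1.mpr ⟨s₀ + t, ?_⟩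
    rw [h2, Φ.right_inv h3, map_smul, hAw, ← hs₀]
    simp only [add_smul, add_assoc]
  obtain ⟨v, a, hv, hCv⟩ := (hc C hC).exists_eq_circleThroughZero (h0 C hC)
  have hder : HasDerivAt (fun t : ℝ => F (t • M u)) (M u) 0 := by
    have h1 : HasDerivAt (fun t : ℝ => t • M u) (M u) 0 := by
      simpa using (hasDerivAt_id (0 : ℝ)).smul_const (M u)
    have h2 : HasFDerivAt F (ContinuousLinearMap.id ℝ R4) ((0 : ℝ) • M u) := by simpa using hFd
    have h3 := h2.comp_hasDerivAt 0 h1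
    rwa [ContinuousLinearMap.id_apply] at h3
  have hspan := mem_span_of_hasDerivAt_circle hder (by simpa using hF0) (by rwa [hCv] at hmem)
  obtain ⟨r, hr⟩ := Submodule.mem_span_singleton.mp hspan
  have hr0 : r ≠ 0 := by
    rintro rfl
    rw [zero_smul] at hr
    exact hw hr.symm
  exact ⟨M u, a, hw, by rw [hCv, ← hr, circleThroughZero_smul v a hr0], hmem⟩

/-- The derivatives at `0` of a curve with components `γ i`, contained in the circle
`x = |x|² α + s W`, `s ∈ ℝ`: they are determined by the derivatives of lower order and by `α`, up to
multiples of `W`. -/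
theorem wedge_iteratedDeriv_of_circle {γ : Fin 4 → ℝ → ℝ} {W α : Fin 4 → ℝ}
    (hγ : ∀ i, ContDiff ℝ ∞ (γ i)) (h0 : ∀ i, γ i 0 = 0) (h1 : ∀ i, iteratedDeriv 1 (γ i) 0 = W i)
    (hc : ∀ᶠ t in 𝓝 (0 : ℝ), ∃ s : ℝ, ∀ i, γ i t = (∑ k, γ k t ^ 2) * α i + s * W i) (i j : Fin 4) :
    (iteratedDeriv 2 (γ i) 0 * W j - iteratedDeriv 2 (γ j) 0 * W i
      = 2 * (∑ k, W k ^ 2) * (α i * W j - α j * W i)) ∧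
    (iteratedDeriv 3 (γ i) 0 * W j - iteratedDeriv 3 (γ j) 0 * W i
      = 6 * (∑ k, W k * iteratedDeriv 2 (γ k) 0) * (α i * W j - α j * W i)) ∧
    (iteratedDeriv 4 (γ i) 0 * W j - iteratedDeriv 4 (γ j) 0 * W i
      = (8 * (∑ k, W k * iteratedDeriv 3 (γ k) 0) + 6 * ∑ k, iteratedDeriv 2 (γ k) 0 ^ 2)
        * (α i * W j - α j * W i)) := by
  have hev : (fun t => γ i t * W j - γ j t * W i)
      =ᶠ[𝓝 0] fun t => (∑ k, γ k t * γ k t) * (α i * W j - α j * W i) := by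
    filter_upwards [hc] with t ⟨s, hs⟩
    have hsq : ∑ k, γ k t * γ k t = ∑ k, γ k t ^ 2 :=
      Finset.sum_congr rfl fun k _ => (sq _).symm
    rw [hsq]
    linear_combination W j * hs i - W i * hs j
  have hat : ∀ (n : ℕ) k, ContDiffAt ℝ n (γ k) 0 := fun n k =>
    ((hγ k).of_le (by exact_mod_cast le_top)).contDiffAt
  have key : ∀ n : ℕ, iteratedDeriv n (γ i) 0 * W j - iteratedDeriv n (γ j) 0 * W i
      = (∑ k, ∑ m ∈ Finset.range (n + 1),
        n.choose m * iteratedDeriv m (γ k) 0 * iteratedDeriv (n - m) (γ k) 0)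
        * (α i * W j - α j * W i) := by
    intro n
    have h := hev.iteratedDeriv_eq n
    rw [iteratedDeriv_fun_sub ((hat n i).mul contDiffAt_const) ((hat n j).mul contDiffAt_const),
      iteratedDeriv_mul_const_field, iteratedDeriv_mul_const_field, iteratedDeriv_mul_const_field,
      iteratedDeriv_fun_sum fun k _ => (hat n k).mul (hat n k)] at h
    rw [h]
    congr 1
    exact Finset.sum_congr rfl fun k _ => iteratedDeriv_fun_mul (hat n k) (hat n k)
  refine ⟨?_, ?_, ?_⟩
  · rw [key 2]
    congr 1
    rw [Finset.mul_sum]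
    refine Finset.sum_congr rfl fun k _ => ?_
    simp [Finset.sum_range_succ, h0, h1, -iteratedDeriv_one]
    ring
  · rw [key 3]
    congr 1
    rw [Finset.mul_sum]
    refine Finset.sum_congr rfl fun k _ => ?_
    simp [Finset.sum_range_succ, h0, h1, -iteratedDeriv_one]
    ring
  · rw [key 4]
    congr 1
    rw [Finset.mul_sum, Finset.mul_sum, ← Finset.sum_add_distrib]
    refine Finset.sum_congr rfl fun k _ => ?_
    simp [Finset.sum_range_succ, h0, h1, -iteratedDeriv_one, Nat.choose]
    ring

/-- The derivatives of a smooth function along the line spanned by `w` are the diagonal values of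
its higher differentials. -/
theorem iteratedDeriv_comp_smul_eq {E : Type*} [NormedAddCommGroup E] [NormedSpace ℝ E]
    {f : E → ℝ} (hf : ContDiff ℝ ∞ f) (n : ℕ) (w : E) :
    iteratedDeriv n (fun t : ℝ => f (t • w)) 0 = iteratedFDeriv ℝ n f 0 fun _ => w := by
  have h := (ContinuousLinearMap.toSpanSingleton ℝ w).iteratedFDeriv_comp_right hf 0
    (i := n) (by exact_mod_cast le_top)
  have h2 : f ∘ (ContinuousLinearMap.toSpanSingleton ℝ w) = fun t : ℝ => f (t • w) := by
    ext t
    simp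
  rw [iteratedDeriv_eq_iteratedFDeriv, ← h2, h]
  simp

/-! ### Quaternionic fractional transformations -/

theorem Quaternion.mul_self_of_re_eq_zero {b : ℍ[ℝ]} (hb : b.re = 0) (w : ℍ[ℝ]) :
    b * (b * w) = (-‖b‖ ^ 2) • w := by
  have h1 : b * b = -((Quaternion.normSq b : ℝ) : ℍ[ℝ]) := by
    rw [← Quaternion.self_mul_star, Quaternion.star_eq_neg.mpr hb, mul_neg, neg_neg]
  rw [← mul_assoc, h1, Quaternion.normSq_eq_norm_mul_self, ← sq, neg_mul,
    Quaternion.coe_mul_eq_smul, neg_smul]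

theorem Quaternion.norm_sq_smul_one_add_smul {b : ℍ[ℝ]} (hb : b.re = 0) (s t : ℝ) :
    ‖(s : ℍ[ℝ]) + t • b‖ ^ 2 = s ^ 2 + t ^ 2 * ‖b‖ ^ 2 := by
  simp only [sq ‖_‖, ← Quaternion.normSq_eq_norm_mul_self, Quaternion.normSq_def']
  simp [hb]
  ring

/-- The quaternionic form of the circle: if `y` is the image of `t w` under
`x ↦ (1 + β(x))⁻¹ x`, then `y` lies on the circle with tangent vector `w` and curvature vector
`- 2 β(w) w / |w|²`. -/
theorem Quaternion.exists_circle_of_fractional {b W Y : ℍ[ℝ]} {t : ℝ} (hb : b.re = 0) (hW : W ≠ 0)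
    (hY : Y + t • (b * Y) = t • W) :
    ∃ s : ℝ, Y = -(‖Y‖ ^ 2 / ‖W‖ ^ 2) • (b * W) + s • W := by
  have hW2 : ‖W‖ ^ 2 ≠ 0 := by positivity
  have hD : 1 + t ^ 2 * ‖b‖ ^ 2 ≠ 0 := by positivity
  have h1 : (1 + t ^ 2 * ‖b‖ ^ 2) • Y = t • W - t ^ 2 • (b * W) := by
    have h2 := congrArg (fun q => b * q) hY
    simp only [mul_add, mul_smul_comm, Quaternion.mul_self_of_re_eq_zero hb] at h2
    linear_combination (norm := module) hY - t • h2
  have h2 : (1 + t ^ 2 * ‖b‖ ^ 2) * ‖Y‖ ^ 2 = t ^ 2 * ‖W‖ ^ 2 := by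
    have h3 : ((1 : ℝ) + t • b) * Y = t • W := by
      rw [← hY, add_mul, smul_mul_assoc, Quaternion.coe_one, one_mul]
    have h4 := congrArg (fun q => ‖q‖ ^ 2) h3
    simp only [norm_mul, mul_pow, Quaternion.norm_sq_smul_one_add_smul hb, norm_smul,
      Real.norm_eq_abs, sq_abs, one_pow] at h4
    exact h4
  refine ⟨t / (1 + t ^ 2 * ‖b‖ ^ 2), ?_⟩
  have h3 : ‖Y‖ ^ 2 / ‖W‖ ^ 2 = t ^ 2 / (1 + t ^ 2 * ‖b‖ ^ 2) := by
    field_simp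
    linear_combination h2
  rw [h3]
  refine smul_right_injective _ hD ?_
  simp only [smul_add, smul_smul, h1, mul_neg, mul_div_cancel₀ _ hD]
  module

/-- The converse of `Quaternion.exists_circle_of_fractional`. The inequality excludes the point of
the circle which corresponds to the point at infinity of the line. -/
theorem Quaternion.exists_fractional_of_circle {b W Y : ℍ[ℝ]} {s : ℝ} (hb : b.re = 0) (hW : W ≠ 0)
    (hlt : ‖b‖ * ‖Y‖ < ‖W‖) (hY : Y = -(‖Y‖ ^ 2 / ‖W‖ ^ 2) • (b * W) + s • W) :
    ∃ t : ℝ, Y + t • (b * Y) = t • W := by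
  have hW2 : ‖W‖ ^ 2 ≠ 0 := by positivity
  set ν := ‖Y‖ ^ 2 / ‖W‖ ^ 2 with hν
  have hνY : ‖Y‖ ^ 2 = ν * ‖W‖ ^ 2 := by rw [hν]; field_simp
  have hD : 0 < 1 - ν * ‖b‖ ^ 2 := by
    have h1 : (‖b‖ * ‖Y‖) ^ 2 < ‖W‖ ^ 2 := by gcongr
    have h2 : ν * ‖b‖ ^ 2 = (‖b‖ * ‖Y‖) ^ 2 / ‖W‖ ^ 2 := by rw [hν]; ring
    rw [h2, sub_pos, div_lt_one (by positivity)]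
    exact h1
  have hs : s ^ 2 = ν * (1 - ν * ‖b‖ ^ 2) := by
    have h3 : Y = ((s : ℍ[ℝ]) + (-ν) • b) * W := by
      rw [add_mul, smul_mul_assoc, Quaternion.coe_mul_eq_smul, add_comm]
      exact hY
    have h4 := congrArg (fun q => ‖q‖ ^ 2) h3
    simp only [norm_mul, mul_pow, Quaternion.norm_sq_smul_one_add_smul hb, hνY, neg_sq] at h4
    have := mul_right_cancel₀ hW2 h4
    linear_combination -this
  refine ⟨s / (1 - ν * ‖b‖ ^ 2), ?_⟩
  have h5 : b * Y = (ν * ‖b‖ ^ 2) • W + s • (b * W) := by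
    have h6 := congrArg (fun q => b * q) hY
    simp only [mul_add, mul_smul_comm, Quaternion.mul_self_of_re_eq_zero hb] at h6
    linear_combination (norm := module) h6
  refine smul_right_injective _ hD.ne' ?_
  change (1 - ν * ‖b‖ ^ 2) • (Y + _ • (b * Y)) = (1 - ν * ‖b‖ ^ 2) • (_ • W)
  rw [smul_add, smul_smul, smul_smul, mul_div_cancel₀ _ hD.ne', h5]
  have h7 : (s * s) • (b * W) = (ν * (1 - ν * ‖b‖ ^ 2)) • (b * W) := by rw [← hs, sq]
  linear_combination (norm := module) (1 - ν * ‖b‖ ^ 2) • hY + h7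

/-- The linear map `x ↦ β(x) y` in quaternionic notation. -/
noncomputable def quatMulRight (e : R4 ≃ₗᵢ[ℝ] ℍ[ℝ]) (β : R4 →L[ℝ] ℍ[ℝ]) (y : R4) : R4 →L[ℝ] R4 :=
  (e.symm.toContinuousLinearEquiv : ℍ[ℝ] →L[ℝ] R4).comp
    (((ContinuousLinearMap.mul ℝ ℍ[ℝ]).flip (e y)).comp β)

theorem quatMulRight_apply (e : R4 ≃ₗᵢ[ℝ] ℍ[ℝ]) (β : R4 →L[ℝ] ℍ[ℝ]) (y x : R4) :
    quatMulRight e β y x = e.symm (β x * e y) := rfl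

theorem norm_quatMulRight_le (e : R4 ≃ₗᵢ[ℝ] ℍ[ℝ]) (β : R4 →L[ℝ] ℍ[ℝ]) (y : R4) :
    ‖quatMulRight e β y‖ ≤ ‖β‖ * ‖y‖ := by
  refine ContinuousLinearMap.opNorm_le_bound _ (by positivity) fun x => ?_
  rw [quatMulRight_apply, LinearIsometryEquiv.norm_map, norm_mul, LinearIsometryEquiv.norm_map]
  calc ‖β x‖ * ‖y‖ ≤ (‖β‖ * ‖x‖) * ‖y‖ := by gcongr; exact β.le_opNorm x
    _ = ‖β‖ * ‖y‖ * ‖x‖ := by ring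

theorem contDiff_quatMulRight (e : R4 ≃ₗᵢ[ℝ] ℍ[ℝ]) (β : R4 →L[ℝ] ℍ[ℝ]) :
    ContDiff ℝ ∞ (quatMulRight e β) := by
  unfold quatMulRight
  refine contDiff_const.clm_comp (ContDiff.clm_comp ?_ contDiff_const)
  exact (ContinuousLinearMap.contDiff _).comp e.contDiff

theorem one_add_ne_zero_of_re_eq_zero {b : ℍ[ℝ]} (hb : b.re = 0) : 1 + b ≠ 0 := fun h => by
  have := congrArg (fun q : ℍ[ℝ] => q.re) h
  simp [hb] at this

theorem isUnit_one_sub_quatMulRight {e : R4 ≃ₗᵢ[ℝ] ℍ[ℝ]} {β : R4 →L[ℝ] ℍ[ℝ]} {y : R4}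
    (hy : ‖β‖ * ‖y‖ < 1) : IsUnit (1 - quatMulRight e β y) :=
  (Units.oneSub _ ((norm_quatMulRight_le e β y).trans_lt hy)).isUnit

/-- The equation `y = (1 + β(x))⁻¹ x` is linear in `x`. -/
theorem eq_inv_mul_iff_sub_quatMulRight {e : R4 ≃ₗᵢ[ℝ] ℍ[ℝ]} {β : R4 →L[ℝ] ℍ[ℝ]}
    (hβ : ∀ x, (β x).re = 0) {x y : R4} :
    e.symm ((1 + β x)⁻¹ * e x) = y ↔ (1 - quatMulRight e β y) x = y := by
  have hne := one_add_ne_zero_of_re_eq_zero (hβ x)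
  rw [sub_apply, one_apply_eq_self, quatMulRight_apply,
    LinearIsometryEquiv.symm_apply_eq, inv_mul_eq_iff_eq_mul₀ hne, sub_eq_iff_eq_add,
    ← e.injective.eq_iff (a := x), map_add, LinearIsometryEquiv.apply_symm_apply, add_mul, one_mul]

theorem isUnit_apply_eq_iff {u : R4 →L[ℝ] R4} (hu : IsUnit u) {x y : R4} :
    Ring.inverse u y = x ↔ u x = y := by
  constructor
  · rintro rfl
    exact congrArg (fun T : R4 →L[ℝ] R4 => T y) (Ring.mul_inverse_cancel u hu)
  · rintro rfl
    exact congrArg (fun T : R4 →L[ℝ] R4 => T x) (Ring.inverse_mul_cancel u hu)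

/-- The transformation `x ↦ (1 + β(x))⁻¹ x` with `β` linear and imaginary valued, on a
neighbourhood of the origin in which it is a diffeomorphism. -/
theorem exists_openPartialHomeomorph_fractional (e : R4 ≃ₗᵢ[ℝ] ℍ[ℝ]) {β : R4 →L[ℝ] ℍ[ℝ]}
    (hβ : ∀ x, (β x).re = 0) :
    ∃ T : OpenPartialHomeomorph R4 R4, (∀ x, e (T x) = (1 + β x)⁻¹ * e x) ∧
      IsDiffeoNearZero T.symm ∧ (∀ y ∈ T.target, ‖β‖ * ‖y‖ < 1) ∧
      ∀ y ∈ T.target, ∀ x, T.symm y = x ↔ (1 - quatMulRight e β y) x = y := by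
  let f : R4 → R4 := fun x => e.symm ((1 + β x)⁻¹ * e x)
  let g : R4 → R4 := fun y => Ring.inverse (1 - quatMulRight e β y) y
  let V : Set R4 := {y | ‖β‖ * ‖y‖ < 1}
  have hV : IsOpen V := isOpen_lt (by fun_prop) continuous_const
  have hf : ContDiff ℝ ∞ f := by
    have h1 : ContDiff ℝ ∞ fun x => (1 + β x)⁻¹ := by
      refine contDiff_iff_contDiffAt.mpr fun x => ?_
      have h2 := contDiffAt_ringInverse ℝ (n := ∞)
        (Units.mk0 (1 + β x) (one_add_ne_zero_of_re_eq_zero (hβ x)))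
      rw [Ring.inverse_eq_inv'] at h2
      exact h2.comp x (contDiff_const.add β.contDiff).contDiffAt
    exact e.symm.contDiff.comp (h1.mul e.contDiff)
  have hg : ContDiffOn ℝ ∞ g V := by
    intro y hy
    refine ContDiffAt.contDiffWithinAt ?_
    obtain ⟨u, hu⟩ := isUnit_one_sub_quatMulRight (e := e) hy
    have h2 := contDiffAt_ringInverse ℝ (n := ∞) u
    rw [hu] at h2
    exact (h2.comp y (contDiff_const.sub (contDiff_quatMulRight e β)).contDiffAt).clm_apply
      contDiffAt_id
  have hfg : ∀ y ∈ V, ∀ x, g y = x ↔ f x = y := fun y hy x =>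
    (isUnit_apply_eq_iff (isUnit_one_sub_quatMulRight hy)).trans
      (eq_inv_mul_iff_sub_quatMulRight hβ).symm
  let T : OpenPartialHomeomorph R4 R4 :=
    { toFun := f
      invFun := g
      source := f ⁻¹' V
      target := V
      map_source' := fun x hx => hx
      map_target' := fun y hy => by
        have := (hfg y hy _).mp rfl
        simpa only [Set.mem_preimage, this] using hy
      left_inv' := fun x hx => (hfg _ hx _).mpr rfl
      right_inv' := fun y hy => (hfg y hy _).mp rfl
      open_source := hV.preimage hf.continuous
      open_target := hV
      continuousOn_toFun := hf.continuous.continuousOn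
      continuousOn_invFun := hg.continuousOn }
  refine ⟨T, fun x => e.apply_symm_apply _, ⟨?_, hg, hf.contDiffOn⟩, fun y hy => hy, fun y hy x =>
    isUnit_apply_eq_iff (isUnit_one_sub_quatMulRight hy)⟩
  change ‖β‖ * ‖(0 : R4)‖ < 1
  simp

/-- Let `β` be linear with imaginary values. The transformation `x ↦ (1 + β(x))⁻¹ x` takes lines
through `0` to circles, namely the line spanned by `w` to the circle with tangent vector `w` and
curvature vector `- 2 β(w) w / |w|²` modulo `w`. -/
theorem exists_fractional_sendsToLines (e : R4 ≃ₗᵢ[ℝ] ℍ[ℝ]) {β : R4 →L[ℝ] ℍ[ℝ]}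
    (hβ : ∀ x, (β x).re = 0) {S : Set (Set R4)}
    (hS : ∀ C ∈ S, ∃ w a : R4, w ≠ 0 ∧ C = circleThroughZero w a ∧
      ∃ s : ℝ, ‖w‖ ^ 2 • e a = -(β w * e w) + s • e w) :
    ∃ T : OpenPartialHomeomorph R4 R4, IsLeftQuatFractional e T ∧ IsDiffeoNearZero T.symm ∧
      SendsToLines T.symm S := by
  obtain ⟨T, hT, hdiff, hlt, hTs⟩ := exists_openPartialHomeomorph_fractional e hβ
  refine ⟨T, ?_, hdiff, fun C hC => ?_⟩
  · have hA : ∀ x, (e.toLinearEquiv : R4 →ₗ[ℝ] ℍ[ℝ]).toAffineMap x = e x := fun x => rfl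
    have hB : ∀ x, (AffineMap.const ℝ R4 (1 : ℍ[ℝ]) + (β : R4 →ₗ[ℝ] ℍ[ℝ]).toAffineMap) x = 1 + β x :=
      fun x => rfl
    refine ⟨(e.toLinearEquiv : R4 →ₗ[ℝ] ℍ[ℝ]).toAffineMap,
      AffineMap.const ℝ R4 1 + (β : R4 →ₗ[ℝ] ℍ[ℝ]).toAffineMap, fun x _ => ?_⟩
    rw [hA, hB]
    exact ⟨one_add_ne_zero_of_re_eq_zero (hβ x), hT x⟩
  obtain ⟨w, a, hw, rfl, s₀, hs₀⟩ := hS C hC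
  refine ⟨_, ⟨0, w, hw, rfl⟩, fun y hy => ?_⟩
  have hW : e w ≠ 0 := by simpa using hw
  have hw2 : ‖w‖ ^ 2 ≠ 0 := by positivity
  have hea : e a = -(‖w‖ ^ 2)⁻¹ • (β w * e w) + ((‖w‖ ^ 2)⁻¹ * s₀) • e w := by
    refine smul_right_injective _ hw2 ?_
    simp only [smul_add, smul_smul, mul_neg, mul_inv_cancel₀ hw2, hs₀, mul_inv_cancel_left₀ hw2]
    module
  have hcirc : y ∈ circleThroughZero w a ↔
      ∃ s : ℝ, e y = -(‖e y‖ ^ 2 / ‖e w‖ ^ 2) • (β w * e w) + s • e w := by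
    simp only [circleThroughZero, Set.mem_ofPred_eq, LinearIsometryEquiv.norm_map]
    constructor
    · rintro ⟨s, hs⟩
      refine ⟨‖y‖ ^ 2 * ((‖w‖ ^ 2)⁻¹ * s₀) + s, ?_⟩
      have h1 := congrArg e hs
      rw [map_add, map_smul, map_smul, hea] at h1
      rw [div_eq_mul_inv]
      linear_combination (norm := module) h1
    · rintro ⟨s, hs⟩
      refine ⟨s - ‖y‖ ^ 2 * ((‖w‖ ^ 2)⁻¹ * s₀), e.injective ?_⟩
      rw [map_add, map_smul, map_smul, hea]
      rw [div_eq_mul_inv] at hs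
      linear_combination (norm := module) hs
  have hline : ∀ t : ℝ, T.symm y = t • w ↔ e y + t • (β w * e y) = t • e w := by
    intro t
    rw [hTs y hy, sub_apply, one_apply_eq_self,
      quatMulRight_apply, sub_eq_iff_eq_add, ← e.injective.eq_iff, map_add,
      LinearIsometryEquiv.apply_symm_apply, map_smul, map_smul, smul_mul_assoc, eq_comm]
  rw [hcirc]
  simp only [Set.mem_range, zero_add]
  constructor
  · rintro ⟨s, hs⟩
    have hlt' : ‖β w‖ * ‖e y‖ < ‖e w‖ := by
      rw [LinearIsometryEquiv.norm_map, LinearIsometryEquiv.norm_map]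
      have h1 := hlt y hy
      have h2 : 0 < ‖w‖ := norm_pos_iff.mpr hw
      calc ‖β w‖ * ‖y‖ ≤ (‖β‖ * ‖w‖) * ‖y‖ := by gcongr; exact β.le_opNorm w
        _ = (‖β‖ * ‖y‖) * ‖w‖ := by ring
        _ < 1 * ‖w‖ := by gcongr
        _ = ‖w‖ := one_mul _
    obtain ⟨t, ht⟩ := Quaternion.exists_fractional_of_circle (hβ w) hW hlt' hs
    exact ⟨t, ((hline t).mpr ht).symm⟩
  · rintro ⟨t, ht⟩
    exact Quaternion.exists_circle_of_fractional (hβ w) hW ((hline t).mp ht.symm)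

/-! ### From the second derivative to the fractional transformation -/

/-- Let `D` be the second derivative of a map taking lines to the circles of `S`. If `D w̄` is
divisible by `|w|²`, so that `D = B(w) w` with linear `B`, the circles come from a left fractional
transformation. -/
theorem exists_left_fractional_of_mul_star {e : R4 ≃ₗᵢ[ℝ] ℍ[ℝ]} {D : R4 → ℍ[ℝ]}
    (hD : ∀ (t : ℝ) w, D (t • w) = t ^ 2 • D w) {b : Fin 4 → MvPolynomial (Fin 4) ℝ}
    (hb : ∀ w : R4, D w * star (e w)
      = ‖w‖ ^ 2 • quatOfFun fun k => MvPolynomial.eval (fun i => w i) (b k))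
    {S : Set (Set R4)} (hS : ∀ C ∈ S, ∃ w a : R4, w ≠ 0 ∧ C = circleThroughZero w a ∧
      ∃ c : ℝ, (2 * ‖w‖ ^ 2) • e a = D w + c • e w) :
    ∃ T : OpenPartialHomeomorph R4 R4, IsLeftQuatFractional e T ∧ IsDiffeoNearZero T.symm ∧
      SendsToLines T.symm S := by
  have hhom : ∀ (t : ℝ) (w : R4), D (t • w) * star (e (t • w)) = t ^ 3 • (D w * star (e w)) := by
    intro t w
    rw [hD, map_smul, Quaternion.star_smul, smul_mul_smul_comm, ← pow_succ]
  obtain ⟨B₀, hB₀⟩ := exists_linear_of_norm_sq_mul (b := b 0)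
    (g := fun w => (D w * star (e w)).re) (fun t w => by rw [hhom]; simp) fun w => by rw [hb]; simp
  obtain ⟨B₁, hB₁⟩ := exists_linear_of_norm_sq_mul (b := b 1)
    (g := fun w => (D w * star (e w)).imI) (fun t w => by rw [hhom]; simp) fun w => by rw [hb]; simp
  obtain ⟨B₂, hB₂⟩ := exists_linear_of_norm_sq_mul (b := b 2)
    (g := fun w => (D w * star (e w)).imJ) (fun t w => by rw [hhom]; simp) fun w => by rw [hb]; simp
  obtain ⟨B₃, hB₃⟩ := exists_linear_of_norm_sq_mul (b := b 3)
    (g := fun w => (D w * star (e w)).imK) (fun t w => by rw [hhom]; simp) fun w => by rw [hb]; simp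
  -- the real part of `B` contributes a multiple of `w` to `D w` and is dropped; the factor comes
  -- from the second derivative `-2 β(w) w` of `t ↦ (1 + t β(w))⁻¹ (t w)` at `t = 0`
  let β' : R4 →ₗ[ℝ] ℍ[ℝ] :=
    { toFun := fun w => (-(1 / 2) : ℝ) • quatOfFun ![0, B₁ w, B₂ w, B₃ w]
      map_add' := fun x y => by ext <;> simp <;> ring
      map_smul' := fun t x => by ext <;> simp <;> ring }
  let β : R4 →L[ℝ] ℍ[ℝ] := LinearMap.toContinuousLinearMap β'
  have hβ' : ∀ w, β w = (-(1 / 2) : ℝ) • quatOfFun ![0, B₁ w, B₂ w, B₃ w] := fun w => rfl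
  have hβ : ∀ w, (β w).re = 0 := fun w => by rw [hβ']; simp
  refine exists_fractional_sendsToLines e hβ fun C hC => ?_
  obtain ⟨w, a, hw, hCw, c, hc⟩ := hS C hC
  refine ⟨w, a, hw, hCw, (B₀ w + c) / 2, ?_⟩
  have hw2 : ‖w‖ ^ 2 ≠ 0 := by positivity
  have hquat : quatOfFun (fun k => MvPolynomial.eval (fun i => w i) (b k))
      = ((B₀ w : ℝ) : ℍ[ℝ]) - (2 : ℝ) • β w := by
    rw [hβ']
    ext <;> simp [hB₀, hB₁, hB₂, hB₃]
  have hDw : D w = B₀ w • e w - (2 : ℝ) • (β w * e w) := by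
    have h1 := congrArg (fun q => q * e w) (hb w)
    simp only [mul_assoc, Quaternion.star_mul_self, Quaternion.normSq_eq_norm_mul_self, ← sq,
      LinearIsometryEquiv.norm_map, Quaternion.mul_coe_eq_smul, hquat, smul_mul_assoc] at h1
    have h2 := smul_right_injective _ hw2 h1
    rw [h2, sub_mul, smul_mul_assoc, Quaternion.coe_mul_eq_smul]
  rw [hDw] at hc
  refine smul_right_injective _ (two_ne_zero (α := ℝ)) ?_
  change (2 : ℝ) • ‖w‖ ^ 2 • e a = (2 : ℝ) • _
  rw [smul_smul, hc]
  module

/-- Quaternionic conjugation as an isometry. -/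
def quatConj : ℍ[ℝ] ≃ₗᵢ[ℝ] ℍ[ℝ] where
  toFun := star
  invFun := star
  left_inv := star_star
  right_inv := star_star
  map_add' := star_add
  map_smul' := fun t x => by simp
  norm_map' := norm_star

theorem quatConj_apply (q : ℍ[ℝ]) : quatConj q = star q := rfl

/-- Conjugation exchanges left and right fractional transformations. -/
theorem IsLeftQuatFractional.isRight_of_conj {e : R4 ≃ₗᵢ[ℝ] ℍ[ℝ]}
    {T : OpenPartialHomeomorph R4 R4} (h : IsLeftQuatFractional (e.trans quatConj) T) :
    IsRightQuatFractional e T := by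
  obtain ⟨A, B, hAB⟩ := h
  let κ : ℍ[ℝ] →ᵃ[ℝ] ℍ[ℝ] := (quatConj.toLinearEquiv : ℍ[ℝ] →ₗ[ℝ] ℍ[ℝ]).toAffineMap
  have hκ : ∀ q, κ q = star q := fun q => rfl
  refine ⟨κ.comp A, κ.comp B, fun x hx => ?_⟩
  obtain ⟨h1, h2⟩ := hAB x hx
  rw [AffineMap.comp_apply, AffineMap.comp_apply, hκ, hκ]
  refine ⟨star_ne_zero.mpr h1, ?_⟩
  rw [LinearIsometryEquiv.trans_apply, quatConj_apply] at h2
  rw [← star_star (e (T x)), h2, star_mul, star_inv₀]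

/-- The mirror image of `exists_left_fractional_of_mul_star`, obtained from it by conjugation. -/
theorem exists_right_fractional_of_star_mul {e : R4 ≃ₗᵢ[ℝ] ℍ[ℝ]} {D : R4 → ℍ[ℝ]}
    (hD : ∀ (t : ℝ) w, D (t • w) = t ^ 2 • D w) {b : Fin 4 → MvPolynomial (Fin 4) ℝ}
    (hb : ∀ w : R4, star (e w) * D w
      = ‖w‖ ^ 2 • quatOfFun fun k => MvPolynomial.eval (fun i => w i) (b k))
    {S : Set (Set R4)} (hS : ∀ C ∈ S, ∃ w a : R4, w ≠ 0 ∧ C = circleThroughZero w a ∧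
      ∃ c : ℝ, (2 * ‖w‖ ^ 2) • e a = D w + c • e w) :
    ∃ T : OpenPartialHomeomorph R4 R4, IsRightQuatFractional e T ∧ IsDiffeoNearZero T.symm ∧
      SendsToLines T.symm S := by
  have hb' : ∀ w : R4, star (D w) * star (e.trans quatConj w)
      = ‖w‖ ^ 2 • quatOfFun fun k =>
        MvPolynomial.eval (fun i => w i) (![b 0, -b 1, -b 2, -b 3] k) := fun w => by
    have := congrArg star (hb w)
    rw [star_mul, star_star, Quaternion.star_smul] at this
    rw [LinearIsometryEquiv.trans_apply, quatConj_apply, star_star, this]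
    congr 1
    ext <;> simp
  obtain ⟨T, h1, h2, h3⟩ := exists_left_fractional_of_mul_star (S := S)
    (fun t w => by rw [hD, Quaternion.star_smul]) hb' fun C hC => by
      obtain ⟨w, a, hw, hCw, c, hc⟩ := hS C hC
      refine ⟨w, a, hw, hCw, c, ?_⟩
      have := congrArg star hc
      rw [Quaternion.star_smul, star_add, Quaternion.star_smul] at this
      exact this
  exact ⟨T, h1.isRight_of_conj, h2, h3⟩

/-! ### The polynomial identities for the derivatives -/

/-- The components of `e x` for a linear isometry `e` of `ℝ⁴` and the quaternions. -/
noncomputable def quatCoord (e : R4 ≃ₗᵢ[ℝ] ℍ[ℝ]) : R4 ≃ₗᵢ[ℝ] R4 :=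
  e.trans Quaternion.linearIsometryEquivTuple

theorem quatOfFun_quatCoord (e : R4 ≃ₗᵢ[ℝ] ℍ[ℝ]) (x : R4) :
    quatOfFun (fun k => quatCoord e x k) = e x := rfl

theorem sum_quatCoord_sq (e : R4 ≃ₗᵢ[ℝ] ℍ[ℝ]) (x : R4) : ∑ k, quatCoord e x k ^ 2 = ‖x‖ ^ 2 := by
  rw [← (quatCoord e).norm_map x, EuclideanSpace.norm_sq_eq]
  simp

section Jet

variable {e : R4 ≃ₗᵢ[ℝ] ℍ[ℝ]} {F : R4 → R4}

theorem contDiff_quatCoord_comp (hF : ContDiff ℝ ∞ F) (k : Fin 4) :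
    ContDiff ℝ ∞ fun x => quatCoord e (F x) k :=
  (EuclideanSpace.proj k : R4 →L[ℝ] ℝ).contDiff.comp ((quatCoord e).contDiff.comp hF)

/-- The relations between the derivatives along a line which is taken to a circle. -/
theorem wedge_iteratedFDeriv_of_circle (hF : ContDiff ℝ ∞ F) (hF0 : F 0 = 0)
    {p : ℕ → Fin 4 → R4 → ℝ}
    (hp : ∀ n k w, p n k w = iteratedFDeriv ℝ n (fun x => quatCoord e (F x) k) 0 fun _ => w)
    (hp1 : ∀ k w, p 1 k w = quatCoord e w k) {v a : R4}
    (hv : ∀ᶠ t in 𝓝 (0 : ℝ), F (t • v) ∈ circleThroughZero v a) (i j : Fin 4) :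
    (p 2 i v * p 1 j v - p 2 j v * p 1 i v
      = 2 * (∑ k, p 1 k v ^ 2) * (quatCoord e a i * p 1 j v - quatCoord e a j * p 1 i v)) ∧
    (p 3 i v * p 1 j v - p 3 j v * p 1 i v = 6 * (∑ k, p 1 k v * p 2 k v)
      * (quatCoord e a i * p 1 j v - quatCoord e a j * p 1 i v)) ∧
    (p 4 i v * p 1 j v - p 4 j v * p 1 i v
      = (8 * (∑ k, p 1 k v * p 3 k v) + 6 * ∑ k, p 2 k v ^ 2)
        * (quatCoord e a i * p 1 j v - quatCoord e a j * p 1 i v)) := by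
  have hder : ∀ n k, iteratedDeriv n (fun t : ℝ => quatCoord e (F (t • v)) k) 0 = p n k v :=
    fun n k => by
      rw [hp]
      exact iteratedDeriv_comp_smul_eq (contDiff_quatCoord_comp hF k) n v
  have h := wedge_iteratedDeriv_of_circle (γ := fun k t => quatCoord e (F (t • v)) k)
    (W := fun k => p 1 k v) (α := fun k => quatCoord e a k)
    (fun k => (contDiff_quatCoord_comp hF k).comp (contDiff_id.smul contDiff_const))
    (fun k => by simp [hF0]) (fun k => hder 1 k) ?_ i j
  · simpa only [hder] using h
  · filter_upwards [hv] with t ⟨s, hs⟩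
    refine ⟨s, fun k => ?_⟩
    rw [sum_quatCoord_sq, hp1]
    have := congrArg (fun x => quatCoord e x k) hs
    simpa using this

end Jet

open MvPolynomial in
/-- The quotient by the ideal of the null quadric contains `ℝ`. -/
theorem charZero_quotient_span {P : MvPolynomial (Fin 4) ℝ} (hP : Prime P) :
    CharZero (MvPolynomial (Fin 4) ℝ ⧸ Ideal.span {P}) := by
  have : Nontrivial (MvPolynomial (Fin 4) ℝ ⧸ Ideal.span {P}) := by
    rw [Ideal.Quotient.nontrivial_iff, Ne, Ideal.span_singleton_eq_top]
    exact hP.not_isUnit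
  exact charZero_of_injective_algebraMap
    (algebraMap ℝ (MvPolynomial (Fin 4) ℝ ⧸ Ideal.span {P})).injective

open MvPolynomial in
theorem not_sum_X_sq_dvd_linear {l : MvPolynomial (Fin 4) ℝ} (hl : l.IsHomogeneous 1)
    (hl0 : l ≠ 0) : ¬ (∑ i : Fin 4, (X i : MvPolynomial (Fin 4) ℝ) ^ 2) ∣ l := by
  rintro ⟨c, rfl⟩
  have hP : (∑ i : Fin 4, (X i : MvPolynomial (Fin 4) ℝ) ^ 2).IsHomogeneous 2 :=
    IsHomogeneous.sum _ _ _ fun i _ => isHomogeneous_X_pow i 2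
  have h1 := hl.totalDegree hl0
  rw [totalDegree_mul_of_isDomain (left_ne_zero_of_mul hl0) (right_ne_zero_of_mul hl0),
    hP.totalDegree (left_ne_zero_of_mul hl0)] at h1
  omega

open MvPolynomial in
/-- The second derivative of a rectifying map of a bundle of circles in general position for
degree `7` is divisible by `|w|²` after multiplication by `w̄` on one of the two sides. -/
theorem exists_second_derivative_divisible {e : R4 ≃ₗᵢ[ℝ] ℍ[ℝ]} {F : R4 → R4}
    (hF : ContDiff ℝ ∞ F) (hF0 : F 0 = 0)
    (hF1 : HasFDerivAt F (ContinuousLinearMap.id ℝ R4) 0) {S : Set (Set R4)}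
    (hgen : ContainsCirclesInGeneralPosition 7 S)
    (hS : ∀ C ∈ S, ∃ w a : R4, w ≠ 0 ∧ C = circleThroughZero w a ∧
        ∀ᶠ t in 𝓝 (0 : ℝ), F (t • w) ∈ C) :
    ∃ (D : R4 → ℍ[ℝ]) (b : Fin 4 → MvPolynomial (Fin 4) ℝ),
      (∀ (t : ℝ) w, D (t • w) = t ^ 2 • D w) ∧
      ((∀ w : R4, D w * star (e w) = ‖w‖ ^ 2 • quatOfFun fun k => eval (fun i => w i) (b k)) ∨
        (∀ w : R4, star (e w) * D w = ‖w‖ ^ 2 • quatOfFun fun k => eval (fun i => w i) (b k))) ∧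
      ∀ C ∈ S, ∃ w a : R4, w ≠ 0 ∧ C = circleThroughZero w a ∧
        ∃ c : ℝ, (2 * ‖w‖ ^ 2) • e a = D w + c • e w := by
  choose p hhom hp using fun (n : ℕ) (k : Fin 4) => exists_isHomogeneous_eval_eq_multilinear
    (iteratedFDeriv ℝ n (fun x => quatCoord e (F x) k) 0)
  have hp1 : ∀ (k : Fin 4) (w : R4), eval (fun i => w i) (p 1 k) = quatCoord e w k := by
    intro k w
    rw [hp, ← iteratedDeriv_comp_smul_eq (contDiff_quatCoord_comp hF k), iteratedDeriv_one]
    have h1 : HasDerivAt (fun t : ℝ => t • w) w 0 := by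
      simpa using (hasDerivAt_id (0 : ℝ)).smul_const w
    have h2 : HasFDerivAt F (ContinuousLinearMap.id ℝ R4) ((0 : ℝ) • w) := by simpa using hF1
    let ρ : R4 →L[ℝ] ℝ := (EuclideanSpace.proj k : R4 →L[ℝ] ℝ).comp
      ((quatCoord e).toContinuousLinearEquiv : R4 →L[ℝ] R4)
    have h3 := ρ.hasFDerivAt.comp_hasDerivAt (0 : ℝ) (h2.comp_hasDerivAt 0 h1)
    exact h3.deriv
  have hsum : ∑ i, p 1 i ^ 2 = ∑ i : Fin 4, (X i : MvPolynomial (Fin 4) ℝ) ^ 2 := by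
    refine MvPolynomial.funext fun x => ?_
    have h1 := sum_quatCoord_sq e (WithLp.toLp 2 x)
    rw [EuclideanSpace.norm_sq_eq] at h1
    have h2 : ∀ k, eval x (p 1 k) = quatCoord e (WithLp.toLp 2 x) k := fun k =>
      hp1 k (WithLp.toLp 2 x)
    simpa [h2] using h1
  have hnorm : ∀ w : R4, eval (fun i => w i) (∑ i : Fin 4, (X i : MvPolynomial (Fin 4) ℝ) ^ 2)
      = ‖w‖ ^ 2 := fun w => by
    rw [EuclideanSpace.norm_sq_eq]
    simp
  -- all vectors tangent to a circle of `S` satisfy the relations between the derivatives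
  have hrel : ∀ C ∈ S, ∀ v ∈ tangentAtZero C, ∃ a, ∀ᶠ t in 𝓝 (0 : ℝ),
      F (t • v) ∈ circleThroughZero v a := by
    intro C hC v hv
    obtain ⟨w, a, -, rfl, hFw⟩ := hS C hC
    obtain ⟨r, rfl⟩ := Submodule.mem_span_singleton.mp
      (tangentAtZero_circleThroughZero_subset w a hv)
    refine ⟨a, ?_⟩
    rcases eq_or_ne r 0 with rfl | hr
    · refine Filter.Eventually.of_forall fun t => ⟨0, ?_⟩
      simp [hF0]
    · rw [circleThroughZero_smul w a hr]
      have h1 : Filter.Tendsto (fun t : ℝ => t * r) (𝓝 0) (𝓝 0) := by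
        have : Continuous fun t : ℝ => t * r := by fun_prop
        simpa using this.tendsto 0
      filter_upwards [h1.eventually hFw] with t ht
      rwa [smul_smul]
  have hwedge := fun (v a : R4) (hv : ∀ᶠ t in 𝓝 (0 : ℝ), F (t • v) ∈ circleThroughZero v a) =>
    wedge_iteratedFDeriv_of_circle (e := e) hF hF0
      (p := fun n k w => eval (fun i => w i) (p n k)) hp hp1 hv
  set P := ∑ i : Fin 4, (X i : MvPolynomial (Fin 4) ℝ) ^ 2 with hPdef
  obtain ⟨c, hcS, hc⟩ := hgen
  have hw : ∀ m n i j, (p m i * p n j - p m j * p n i).IsHomogeneous (m + n) := fun m n i j => by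
    refine ((hhom m i).mul (hhom n j)).sub ?_
    exact (hhom m j).mul (hhom n i)
  have hs : ∀ m n, (∑ k, p m k * p n k).IsHomogeneous (m + n) := fun m n =>
    IsHomogeneous.sum _ _ _ fun k _ => (hhom m k).mul (hhom n k)
  have hnum : ∀ (r : ℝ) {q : MvPolynomial (Fin 4) ℝ} {n : ℕ}, q.IsHomogeneous n →
      (C r * q).IsHomogeneous n := fun r q n hq => by
    simpa using (isHomogeneous_C (Fin 4) r).mul hq
  have hPhom : P.IsHomogeneous 2 := by
    rw [← hsum]
    simp only [sq]
    exact hs 1 1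
  have h₃ : ∀ i j, 2 * P * (p 3 i * p 1 j - p 3 j * p 1 i)
      = 6 * (∑ k, p 1 k * p 2 k) * (p 2 i * p 1 j - p 2 j * p 1 i) := by
    intro i j
    refine sub_eq_zero.mp (hc.eq_zero_of_le (n := 6) (by norm_num) (IsHomogeneous.sub ?_ ?_) ?_)
    · have := hnum 2 (hPhom.mul (hw 3 1 i j))
      rwa [map_ofNat, ← mul_assoc] at this
    · have := hnum 6 ((hs 1 2).mul (hw 2 1 i j))
      rwa [map_ofNat, ← mul_assoc] at this
    · intro l v hv
      obtain ⟨a, ha⟩ := hrel _ (hcS l) v hv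
      obtain ⟨r2, r3, -⟩ := hwedge v a ha i j
      rw [← hsum]
      simp only [map_sub, map_mul, map_sum, map_pow, map_ofNat]
      linear_combination 2 * (∑ k, eval (fun i => v i) (p 1 k) ^ 2) * r3
        - 6 * (∑ k, eval (fun i => v i) (p 1 k) * eval (fun i => v i) (p 2 k)) * r2
  have h₄ : ∀ i j, 2 * P * (p 4 i * p 1 j - p 4 j * p 1 i)
      = (8 * (∑ k, p 1 k * p 3 k) + 6 * ∑ k, p 2 k ^ 2) * (p 2 i * p 1 j - p 2 j * p 1 i) := by
    intro i j
    refine sub_eq_zero.mp (hc.eq_zero_of_le (n := 7) le_rfl (IsHomogeneous.sub ?_ ?_) ?_)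
    · have := hnum 2 (hPhom.mul (hw 4 1 i j))
      rwa [map_ofNat, ← mul_assoc] at this
    · have h8 := hnum 8 (hs 1 3)
      have h6 := hnum 6 (hs 2 2)
      simp only [map_ofNat, ← sq] at h8 h6
      exact (h8.add h6).mul (hw 2 1 i j)
    · intro l v hv
      obtain ⟨a, ha⟩ := hrel _ (hcS l) v hv
      obtain ⟨r2, -, r4⟩ := hwedge v a ha i j
      rw [← hsum]
      simp only [map_sub, map_add, map_mul, map_sum, map_pow, map_ofNat]
      linear_combination 2 * (∑ k, eval (fun i => v i) (p 1 k) ^ 2) * r4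
        - (8 * (∑ k, eval (fun i => v i) (p 1 k) * eval (fun i => v i) (p 3 k))
          + 6 * ∑ k, eval (fun i => v i) (p 2 k) ^ 2) * r2
  have hne : p 1 0 ≠ 0 := fun h => by
    have h1 := hp1 0 ((quatCoord e).symm (EuclideanSpace.single 0 1))
    rw [h] at h1
    simp at h1
  have hchar := charZero_quotient_span (P := P) prime_sum_X_sq
  have hdvd := dvd_mul_star_or_dvd_star_mul (P := P) prime_sum_X_sq (x := p 1) (d₂ := p 2)
    (d₃ := p 3) (d₄ := p 4) hsum ⟨0, not_sum_X_sq_dvd_linear (hhom 1 0) hne⟩ h₃ h₄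
  let D : R4 → ℍ[ℝ] := fun w => quatOfFun fun k => eval (fun i => w i) (p 2 k)
  have heval : ∀ w : R4, e w = quatOfFun fun k => eval (fun i => w i) (p 1 k) := fun w => by
    rw [← quatOfFun_quatCoord]
    simp only [hp1]
  have hD : ∀ (t : ℝ) w, D (t • w) = t ^ 2 • D w := by
    intro t w
    have h1 : ∀ k, eval (fun i => (t • w) i) (p 2 k) = t ^ 2 * eval (fun i => w i) (p 2 k) := by
      intro k
      rw [hp, hp, ContinuousMultilinearMap.map_smul_univ]
      simp
    simp only [D, h1]
    ext <;> simp
  have hcirc : ∀ C ∈ S, ∃ w a : R4, w ≠ 0 ∧ C = circleThroughZero w a ∧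
      ∃ c : ℝ, (2 * ‖w‖ ^ 2) • e a = D w + c • e w := by
    intro C hC
    obtain ⟨w, a, hw0, hCw, hFw⟩ := hS C hC
    refine ⟨w, a, hw0, hCw, ?_⟩
    have hr := fun i j => (hwedge w a (by rwa [hCw] at hFw) i j).1
    have hE : quatCoord e w ≠ 0 := by simpa using hw0
    obtain ⟨j, hj⟩ : ∃ j, quatCoord e w j ≠ 0 := by
      by_contra! h
      exact hE (PiLp.ext h)
    simp only [hp1, sum_quatCoord_sq] at hr
    -- a vector whose wedge product with `w` vanishes is a multiple of `w`
    set u : Fin 4 → ℝ := fun k => 2 * ‖w‖ ^ 2 * quatCoord e a k - eval (fun i => w i) (p 2 k) with hu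
    refine ⟨u j / quatCoord e w j, ?_⟩
    have hcomp : ∀ i, 2 * ‖w‖ ^ 2 * quatCoord e a i
        = eval (fun i => w i) (p 2 i) + u j / quatCoord e w j * quatCoord e w i := by
      intro i
      rw [hu]
      field_simp
      linear_combination -(hr i j)
    rw [← quatOfFun_quatCoord e a, ← quatOfFun_quatCoord e w]
    ext
    · simpa [D] using hcomp 0
    · simpa [D] using hcomp 1
    · simpa [D] using hcomp 2
    · simpa [D] using hcomp 3
  rcases hdvd with ⟨b, hb⟩ | ⟨b, hb⟩
  · refine ⟨D, b, hD, Or.inl fun w => ?_, hcirc⟩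
    have h := fun (π : ℍ[MvPolynomial (Fin 4) ℝ] → MvPolynomial (Fin 4) ℝ) =>
      congrArg (fun q => eval (fun i => w i) (π q)) hb
    rw [heval, ← hnorm]
    ext
    · simpa [D] using h (·.re)
    · simpa [D] using h (·.imI)
    · simpa [D] using h (·.imJ)
    · simpa [D] using h (·.imK)
  · refine ⟨D, b, hD, Or.inr fun w => ?_, hcirc⟩
    have h := fun (π : ℍ[MvPolynomial (Fin 4) ℝ] → MvPolynomial (Fin 4) ℝ) =>
      congrArg (fun q => eval (fun i => w i) (π q)) hb
    rw [heval, ← hnorm]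
    ext
    · simpa [D] using h (·.re)
    · simpa [D] using h (·.imI)
    · simpa [D] using h (·.imJ)
    · simpa [D] using h (·.imK)

theorem mainTheorem1 :
    ∃ d : ℕ, ∀ S : Set (Set R4),
      IsSimpleBundleOfCircles S →
      ContainsCirclesInGeneralPosition d S →
      IsRectifiable S →
      ∀ e : R4 ≃ₗᵢ[ℝ] ℍ[ℝ],
        ∃ T : OpenPartialHomeomorph R4 R4,
          (IsLeftQuatFractional e T ∨ IsRightQuatFractional e T) ∧
          IsDiffeoNearZero T.symm ∧ SendsToLines T.symm S := by
  refine ⟨7, fun S hS hgen hrect e => ?_⟩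
  obtain ⟨F, hF, hF0, hF1, hFS⟩ := hrect.exists_map_of_circles hS.isCircle hS.zero_mem
  obtain ⟨D, b, hD, hb | hb, hcirc⟩ :=
    exists_second_derivative_divisible (e := e) hF hF0 hF1 hgen hFS
  · obtain ⟨T, hT, hdiff, hlines⟩ := exists_left_fractional_of_mul_star hD hb hcirc
    exact ⟨T, Or.inl hT, hdiff, hlines⟩
  · obtain ⟨T, hT, hdiff, hlines⟩ := exists_right_fractional_of_star_mul hD hb hcirc
    exact ⟨T, Or.inr hT, hdiff, hlines⟩
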